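/- Let $\mathbb{K}$ be an algebraically closed field. For $i\ge 1$ let $Q_i=\left(\mathbb{K}^{i-1},\mathbb{K}^{i};\left[\begin{smallmatrix}I\\0\end{smallmatrix}\right],\left[\begin{smallmatrix}0\\I\end{smallmatrix}\right]\right)$ be the $i$-th preprojective indecomposable representation of the Kronecker quiver $1\rightrightarrows 2$ with arrows $\alpha,\beta$. Let $m,n\ge 0$, let $a_1\ge\dots\ge a_m$ and $d_1\ge\dots\ge d_n$ be positive integers, and put $M=\bigoplus_{i=1}^m Q_{a_i}$ and $N=\bigoplus_{j=1}^n Q_{d_j}$. Let $\phi=(\phi^1,\phi^2)$ be a generic homomorphism from $N$ to $M$, i.e. a pair of matrices with entries in a polynomial ring over $\mathbb{K}$ (in any set of indeterminates) such that $M(\alpha)\phi^1=\phi^2N(\alpha)$ and $M(\beta)\phi^1=\phi^2N(\beta)$, and such that every homomorphism from $N$ to $M$ over $\mathbb{K}$ is obtained from $\phi$ by giving the indeterminates special values in $\mathbb{K}$. (Such a $\phi$ exists: for example, let the $(i,j)$ blocks of $\phi^1$ and $\phi^2$, of sizes $(a_i-1)\times(d_j-1)$ and $a_i\times d_j$, be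 zero if $a_i<d_j$, and otherwise have $x^{ij}_{k+1}$ on the $k$-th diagonal below the main one for $0\le k\le a_i-d_j$ and zeros elsewhere, where the $x^{ij}_k$ are pairwise different indeterminates.) Put $s_0=0$ and define recursively, for $l\ge 1$, $$r_l=\max\{1\le j\le n \mid d_j>a_{s_{l-1}+1}\},\qquad s_l=\max\{1\le i\le m\mid d_{r_l+1}\le a_i\},$$ where undefined numbers ($a_{m+1}$, $d_{n+1}$, the maximum of the empty set) are taken to be $0$; let $t\ge 1$ be the first index with $r_t=n$ (it exists). Then the rank of $\phi^1$, the component of $\phi$ at the vertex $1$, over the field of rational functions in the indeterminates is $$\operatorname{rank}\phi^{1}=\min\Bigl\{\sum_{j=1}^{s_i}(a_j-1)+\sum_{j=r_{i+1}+1}^{r_t}(d_j-1)\;\Big|\;0\le i\le t-1\Bigr\}.$$ -/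

import Mathlib

/-- A Kronecker representation with coefficients in `K`, written as a pair of matrices: the vector
spaces at the vertices `1` and `2` are `V₁ → K` and `V₂ → K`, and the two arrows `1 ⟶ 2` act by the
matrices `α` and `β`. -/
structure KroneckerRep (K V₁ V₂ : Type*) where
  α : Matrix V₂ V₁ K
  β : Matrix V₂ V₁ K

namespace KroneckerRep

/-- The preprojective indecomposable `Q_i = (K^(i-1), K^i; [I; 0], [0; I])`, for `i ≥ 1`. -/
def Q (K : Type*) [Zero K] [One K] (i : ℕ) : KroneckerRep K (Fin (i - 1)) (Fin i) where
  α := Matrix.of fun p q => if (p : ℕ) = q then 1 else 0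
  β := Matrix.of fun p q => if (p : ℕ) = q + 1 then 1 else 0

/-- The direct sum of a family of Kronecker representations. -/
def directSum {K ι : Type*} [Zero K] [DecidableEq ι] {V₁ V₂ : ι → Type*}
    (M : ∀ i, KroneckerRep K (V₁ i) (V₂ i)) : KroneckerRep K (Σ i, V₁ i) (Σ i, V₂ i) where
  α := Matrix.blockDiagonal' fun i => (M i).α
  β := Matrix.blockDiagonal' fun i => (M i).β

/-- The preprojective Kronecker representation `Q_{a_1} ⊕ ⋯ ⊕ Q_{a_m}`. -/
abbrev preprojective (K : Type*) [Zero K] [One K] {m : ℕ} (a : Fin m → ℕ) :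
    KroneckerRep K (Σ i, Fin (a i - 1)) (Σ i, Fin (a i)) :=
  directSum fun i => Q K (a i)

/-- Extension of scalars along a map `f : K → R`. -/
def map {K R V₁ V₂ : Type*} (f : K → R) (M : KroneckerRep K V₁ V₂) : KroneckerRep R V₁ V₂ where
  α := M.α.map f
  β := M.β.map f

/-- The matrix pair `(φ₁, φ₂)` is a homomorphism from `N` to `M`:
`M(α) φ₁ = φ₂ N(α)` and `M(β) φ₁ = φ₂ N(β)`. -/
structure IsHom {R V₁ V₂ W₁ W₂ : Type*} [CommSemiring R] [Fintype V₁] [Fintype W₂]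
    (N : KroneckerRep R W₁ W₂) (M : KroneckerRep R V₁ V₂)
    (φ₁ : Matrix V₁ W₁ R) (φ₂ : Matrix V₂ W₂ R) : Prop where
  comm_α : M.α * φ₁ = φ₂ * N.α
  comm_β : M.β * φ₁ = φ₂ * N.β

/-- The matrix pair `(φ₁, φ₂)` with entries in the polynomial ring `K[x_s | s ∈ σ]` is a generic
homomorphism from `N` to `M`: it is a homomorphism identically in the indeterminates, and the
homomorphisms from `N` to `M` over `K` are exactly the pairs obtained from it by giving the
indeterminates special values in `K` (every specialization is a homomorphism by the first clause).

No normal form of the entries is imposed. The pair given by independent indeterminates along the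
diagonals of the blocks is an instance, see `isGenericHom_diagonalPair`. -/
structure IsGenericHom {K σ V₁ V₂ W₁ W₂ : Type*} [CommSemiring K] [Fintype V₁] [Fintype W₂]
    (N : KroneckerRep K W₁ W₂) (M : KroneckerRep K V₁ V₂)
    (φ₁ : Matrix V₁ W₁ (MvPolynomial σ K)) (φ₂ : Matrix V₂ W₂ (MvPolynomial σ K)) : Prop where
  isHom : IsHom (N.map (MvPolynomial.C (σ := σ))) (M.map (MvPolynomial.C (σ := σ))) φ₁ φ₂
  exists_specialization : ∀ (f₁ : Matrix V₁ W₁ K) (f₂ : Matrix V₂ W₂ K), IsHom N M f₁ f₂ →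
    ∃ x : σ → K, φ₁.map (MvPolynomial.eval x) = f₁ ∧ φ₂.map (MvPolynomial.eval x) = f₂

end KroneckerRep

/-- The rank of a matrix of polynomials, taken over the field of rational functions. -/
noncomputable def polyRank {K σ V W : Type*} [Field K] [Fintype W]
    (A : Matrix V W (MvPolynomial σ K)) : ℕ :=
  (A.map (algebraMap (MvPolynomial σ K) (FractionRing (MvPolynomial σ K)))).rank

namespace KroneckerIndex

/-- The `j`-th term, counted from `1`, of a finite sequence; undefined terms are `0`. -/
def term {m : ℕ} (a : Fin m → ℕ) (j : ℕ) : ℕ :=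
  if h : 1 ≤ j ∧ j ≤ m then a ⟨j - 1, by omega⟩ else 0

/-- The pair `(r_l, s_l)`, with `r_0 = s_0 = 0`,
`r_(l+1) = max {1 ≤ j ≤ n | d_j > a_(s_l + 1)}` and
`s_(l+1) = max {1 ≤ i ≤ m | d_(r_(l+1) + 1) ≤ a_i}`, where the maximum of the empty set is `0`. -/
def rs {m n : ℕ} (a : Fin m → ℕ) (d : Fin n → ℕ) : ℕ → ℕ × ℕ
  | 0 => (0, 0)
  | l + 1 =>
    let r := ((Finset.Icc 1 n).filter fun j => term a ((rs a d l).2 + 1) < term d j).sup id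
    (r, ((Finset.Icc 1 m).filter fun i => term d (r + 1) ≤ term a i).sup id)

/-- The number `r_l`. -/
def r {m n : ℕ} (a : Fin m → ℕ) (d : Fin n → ℕ) (l : ℕ) : ℕ := (rs a d l).1

/-- The number `s_l`. -/
def s {m n : ℕ} (a : Fin m → ℕ) (d : Fin n → ℕ) (l : ℕ) : ℕ := (rs a d l).2

/-- The number `t`: the first `l ≥ 1` with `r_l = n`. It exists by `t_spec`. -/
noncomputable def t {m n : ℕ} (a : Fin m → ℕ) (d : Fin n → ℕ) : ℕ :=
  sInf {l | 1 ≤ l ∧ r a d l = n}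

theorem r_succ {m n : ℕ} (a : Fin m → ℕ) (d : Fin n → ℕ) (l : ℕ) :
    r a d (l + 1) =
      ((Finset.Icc 1 n).filter fun j => term a (s a d l + 1) < term d j).sup id := by
  rw [r, rs, s]

theorem s_succ {m n : ℕ} (a : Fin m → ℕ) (d : Fin n → ℕ) (l : ℕ) :
    s a d (l + 1) =
      ((Finset.Icc 1 m).filter fun i => term d (r a d (l + 1) + 1) ≤ term a i).sup id := by
  rw [r, s, rs]

theorem r_le {m n : ℕ} (a : Fin m → ℕ) (d : Fin n → ℕ) (l : ℕ) : r a d l ≤ n := by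
  cases l with
  | zero => exact Nat.zero_le _
  | succ l =>
    rw [r_succ]
    refine Finset.sup_le fun j hj => ?_
    simp only [Finset.mem_filter, Finset.mem_Icc] at hj
    exact hj.1.2

theorem lt_r {m n : ℕ} {a : Fin m → ℕ} {d : Fin n → ℕ}
    (hd0 : ∀ j, 0 < d j) (l : ℕ) (h1 : 1 ≤ l) (hl : r a d l < n) : r a d l < r a d (l + 1) := by
  obtain ⟨k, rfl⟩ : ∃ k, l = k + 1 := ⟨l - 1, by omega⟩
  rw [r_succ a d (k + 1), ← Nat.succ_le_iff]
  refine Finset.le_sup (f := id) (b := r a d (k + 1) + 1) ?_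
  simp only [Finset.mem_filter, Finset.mem_Icc]
  refine ⟨by omega, ?_⟩
  by_contra hc
  push Not at hc
  have hpos : 0 < term d (r a d (k + 1) + 1) := by
    unfold term
    rw [dif_pos (by omega)]
    exact hd0 _
  have hm : s a d (k + 1) + 1 ≤ m := by
    by_contra hm
    have h0 : term a (s a d (k + 1) + 1) = 0 := dif_neg (by omega)
    omega
  have : s a d (k + 1) + 1 ≤ s a d (k + 1) := by
    conv_rhs => rw [s_succ]
    refine Finset.le_sup (f := id) (b := s a d (k + 1) + 1) ?_
    simp only [Finset.mem_filter, Finset.mem_Icc]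
    exact ⟨by omega, hc⟩
  omega

/-- The recursion reaches `n`, so that `t` is well defined. -/
theorem t_spec {m n : ℕ} {a : Fin m → ℕ} {d : Fin n → ℕ}
    (hd0 : ∀ j, 0 < d j) : 1 ≤ t a d ∧ r a d (t a d) = n := by
  refine Nat.sInf_mem (s := {l | 1 ≤ l ∧ r a d l = n}) ?_
  by_contra hne
  have hne' : ∀ l, 1 ≤ l → r a d l < n := fun l hl =>
    lt_of_le_of_ne (r_le a d l) fun h => hne ⟨l, hl, h⟩
  have key : ∀ l, l ≤ r a d (l + 1) := by
    intro l
    induction l with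
    | zero => exact Nat.zero_le _
    | succ l ih =>
      have := lt_r (a := a) hd0 (l + 1) (by omega) (hne' _ (by omega))
      omega
  have h1 := key n
  have h2 := hne' (n + 1) (by omega)
  omega

end KroneckerIndex

namespace KroneckerRep

/-- The block matrix whose `(i, j)` block, of size `p_i × q_j`, has the indeterminate `x_(i,j,k)`
along its `k`-th lower diagonal for `0 ≤ k ≤ a_i - d_j`, and zeros elsewhere. -/
noncomputable def diagonalMatrix (K : Type*) [CommSemiring K] {m n : ℕ} (a : Fin m → ℕ)
    (d : Fin n → ℕ) (p : Fin m → ℕ) (q : Fin n → ℕ) :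
    Matrix (Σ i, Fin (p i)) (Σ j, Fin (q j)) (MvPolynomial (Fin m × Fin n × ℕ) K) :=
  Matrix.of fun u v =>
    if (v.2 : ℕ) ≤ u.2 ∧ ((u.2 : ℕ) - v.2) + d v.1 ≤ a u.1 then
      MvPolynomial.X (u.1, v.1, (u.2 : ℕ) - v.2) else 0

section entries

variable {R : Type*} [CommSemiring R] {m n : ℕ} {a : Fin m → ℕ} {d : Fin n → ℕ}

theorem mul_entry_α (A : Matrix (Σ i, Fin (a i)) (Σ j, Fin (d j)) R) (u : Σ i, Fin (a i))
    (v : Σ j, Fin (d j - 1)) :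
    (A * (preprojective R d).α) u v = A u ⟨v.1, ⟨v.2, by omega⟩⟩ := by
  obtain ⟨j, q⟩ := v
  rw [Matrix.mul_apply, Fintype.sum_sigma, Finset.sum_eq_single j,
    Finset.sum_eq_single (⟨q, by omega⟩ : Fin (d j))]
  · simp [preprojective, directSum, Q]
  · intro b _ hb
    have : ¬ ((b : ℕ) = q) := fun h => hb (Fin.ext h)
    simp [preprojective, directSum, Q, this]
  · simp
  · intro j' _ hj
    simp [preprojective, directSum, Matrix.blockDiagonal'_apply_ne _ _ _ hj]
  · simp

theorem mul_entry_β (A : Matrix (Σ i, Fin (a i)) (Σ j, Fin (d j)) R) (u : Σ i, Fin (a i))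
    (v : Σ j, Fin (d j - 1)) :
    (A * (preprojective R d).β) u v = A u ⟨v.1, ⟨v.2 + 1, by omega⟩⟩ := by
  obtain ⟨j, q⟩ := v
  rw [Matrix.mul_apply, Fintype.sum_sigma, Finset.sum_eq_single j,
    Finset.sum_eq_single (⟨q + 1, by omega⟩ : Fin (d j))]
  · simp [preprojective, directSum, Q]
  · intro b _ hb
    have : ¬ ((b : ℕ) = q + 1) := fun h => hb (Fin.ext h)
    simp [preprojective, directSum, Q, this]
  · simp
  · intro j' _ hj
    simp [preprojective, directSum, Matrix.blockDiagonal'_apply_ne _ _ _ hj]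
  · simp

theorem entry_α_mul (A : Matrix (Σ i, Fin (a i - 1)) (Σ j, Fin (d j - 1)) R)
    (u : Σ i, Fin (a i)) (v : Σ j, Fin (d j - 1)) :
    ((preprojective R a).α * A) u v =
      if h : (u.2 : ℕ) < a u.1 - 1 then A ⟨u.1, ⟨u.2, h⟩⟩ v else 0 := by
  obtain ⟨i, p⟩ := u
  rw [Matrix.mul_apply, Fintype.sum_sigma, Finset.sum_eq_single i]
  · split_ifs with h
    · rw [Finset.sum_eq_single (⟨p, h⟩ : Fin (a i - 1))]
      · simp [preprojective, directSum, Q]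
      · intro b _ hb
        have : ¬ ((p : ℕ) = b) := fun h => hb (Fin.ext h.symm)
        simp [preprojective, directSum, Q, this]
      · simp
    · refine Finset.sum_eq_zero fun b _ => ?_
      have : ¬ ((p : ℕ) = b) := by
        have := b.2
        simp only at h
        omega
      simp [preprojective, directSum, Q, this]
  · intro i' _ hi
    simp [preprojective, directSum, Matrix.blockDiagonal'_apply_ne _ _ _ hi.symm]
  · simp

theorem entry_β_mul (A : Matrix (Σ i, Fin (a i - 1)) (Σ j, Fin (d j - 1)) R)
    (u : Σ i, Fin (a i)) (v : Σ j, Fin (d j - 1)) :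
    ((preprojective R a).β * A) u v =
      if h : 1 ≤ (u.2 : ℕ) then A ⟨u.1, ⟨u.2 - 1, by omega⟩⟩ v else 0 := by
  obtain ⟨i, p⟩ := u
  rw [Matrix.mul_apply, Fintype.sum_sigma, Finset.sum_eq_single i]
  · split_ifs with h
    · simp only at h
      rw [Finset.sum_eq_single (⟨p - 1, by omega⟩ : Fin (a i - 1))]
      · have : (p : ℕ) = p - 1 + 1 := by omega
        simp [preprojective, directSum, Q, ← this]
      · intro b _ hb
        have : ¬ ((p : ℕ) = b + 1) := fun h => hb (Fin.ext (by simp only; omega))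
        simp [preprojective, directSum, Q, this]
      · simp
    · refine Finset.sum_eq_zero fun b _ => ?_
      have : ¬ ((p : ℕ) = b + 1) := by
        simp only at h
        omega
      simp [preprojective, directSum, Q, this]
  · intro i' _ hi
    simp [preprojective, directSum, Matrix.blockDiagonal'_apply_ne _ _ _ hi.symm]
  · simp

theorem map_preprojective {S : Type*} [CommSemiring S] (f : R →+* S) :
    (preprojective R a).map f = preprojective S a := by
  simp only [map, preprojective, directSum, KroneckerRep.mk.injEq]
  constructor <;>
  · rw [Matrix.blockDiagonal'_map _ _ (map_zero f)]
    congr 1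
    funext i
    ext p q
    simp [Q, apply_ite f]

end entries

/-- The pair of block matrices with independent indeterminates along the diagonals of the blocks is
a generic homomorphism; in particular, generic homomorphisms exist. -/
theorem isGenericHom_diagonalPair {K : Type*} [CommSemiring K] {m n : ℕ} (a : Fin m → ℕ)
    (d : Fin n → ℕ) (hd0 : ∀ j, 0 < d j) :
    IsGenericHom (preprojective K d) (preprojective K a)
      (diagonalMatrix K a d (fun i => a i - 1) (fun j => d j - 1)) (diagonalMatrix K a d a d) := by
  constructor
  · rw [map_preprojective, map_preprojective]
    constructor
    · ext1 u v
      rw [entry_α_mul, mul_entry_α]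
      obtain ⟨i, p⟩ := u
      obtain ⟨j, q⟩ := v
      have := q.2
      simp only [diagonalMatrix, Matrix.of_apply]
      split_ifs <;> first | rfl | omega
    · ext1 u v
      rw [entry_β_mul, mul_entry_β]
      obtain ⟨i, p⟩ := u
      obtain ⟨j, q⟩ := v
      have := p.2
      simp only [diagonalMatrix, Matrix.of_apply]
      by_cases hp : 1 ≤ (p : ℕ)
      · have e : (p : ℕ) - 1 - q = p - (q + 1) := by omega
        rw [dif_pos hp, e]
        congr 1
        exact propext (by omega)
      · rw [dif_neg hp, if_neg (by omega)]
  · intro f₁ f₂ hf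
    have hα : ∀ u v, _ = _ := fun u v => congrFun (congrFun hf.comm_α u) v
    have hβ : ∀ u v, _ = _ := fun u v => congrFun (congrFun hf.comm_β u) v
    simp only [entry_α_mul, mul_entry_α] at hα
    simp only [entry_β_mul, mul_entry_β] at hβ
    -- the entries of `f₂`, indexed by pairs of natural numbers
    let F : Fin m → Fin n → ℕ → ℕ → K := fun i j p q =>
      if h : p < a i ∧ q < d j then f₂ ⟨i, ⟨p, h.1⟩⟩ ⟨j, ⟨q, h.2⟩⟩ else 0
    have hF : ∀ u v, f₂ u v = F u.1 v.1 u.2 v.2 := by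
      rintro ⟨i, p⟩ ⟨j, q⟩
      simp [F]
    have h1 : ∀ u v, f₁ u v = F u.1 v.1 u.2 v.2 := by
      rintro ⟨i, p⟩ ⟨j, q⟩
      have := hα ⟨i, ⟨p, by omega⟩⟩ ⟨j, q⟩
      rw [dif_pos p.2] at this
      rw [← hF ⟨i, ⟨p, by omega⟩⟩ ⟨j, ⟨q, by omega⟩⟩, ← this]
    have hlast : ∀ i j p q, a i ≤ p + 1 → q + 1 < d j → F i j p q = 0 := by
      intro i j p q hp hq
      by_cases hpa : p < a i
      · have := hα ⟨i, ⟨p, hpa⟩⟩ ⟨j, ⟨q, by omega⟩⟩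
        rw [dif_neg (by simp only; omega)] at this
        rw [← hF ⟨i, ⟨p, hpa⟩⟩ ⟨j, ⟨q, by omega⟩⟩, ← this]
      · simp [F, hpa]
    have hfirst : ∀ i j q, F i j 0 (q + 1) = 0 := by
      intro i j q
      by_cases h : 0 < a i ∧ q + 1 < d j
      · have := hβ ⟨i, ⟨0, h.1⟩⟩ ⟨j, ⟨q, by omega⟩⟩
        rw [dif_neg (by simp)] at this
        rw [← hF ⟨i, ⟨0, h.1⟩⟩ ⟨j, ⟨q + 1, h.2⟩⟩, ← this]
      · simp only [F]
        rw [dif_neg h]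
    have hstep : ∀ i j p q, q + 1 < d j → F i j (p + 1) (q + 1) = F i j p q := by
      intro i j p q hq
      by_cases hp : p + 1 < a i
      · have := hβ ⟨i, ⟨p + 1, hp⟩⟩ ⟨j, ⟨q, by omega⟩⟩
        rw [dif_pos (by simp)] at this
        rw [← hF ⟨i, ⟨p + 1, hp⟩⟩ ⟨j, ⟨q + 1, hq⟩⟩, ← this, h1]
        simp
      · rw [hlast i j p q (by omega) hq]
        simp [F, hp]
    -- constancy along the diagonals
    have hdiag : ∀ i j q p, q < d j → F i j p q = if q ≤ p then F i j (p - q) 0 else 0 := by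
      intro i j q
      induction q with
      | zero => simp
      | succ q ih =>
        intro p hq
        cases p with
        | zero => simp [hfirst]
        | succ p =>
          rw [hstep i j p q hq, ih p (by omega)]
          simp
    have hzero : ∀ i j k, a i < k + d j → F i j k 0 = 0 := by
      intro i j k hk
      have hdj := hd0 j
      have := hdiag i j (d j - 1) (k + (d j - 1)) (by omega)
      rw [if_pos (by omega), Nat.add_sub_cancel] at this
      rw [← this]
      simp only [F]
      rw [dif_neg (by omega)]
    have hval : ∀ i j p q, q < d j →
        F i j p q = if q ≤ p ∧ p - q + d j ≤ a i then F i j (p - q) 0 else 0 := by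
      intro i j p q hq
      rw [hdiag i j q p hq]
      by_cases h : q ≤ p
      · by_cases h' : p - q + d j ≤ a i
        · rw [if_pos h, if_pos ⟨h, h'⟩]
        · rw [if_pos h, if_neg (by tauto), hzero i j _ (by omega)]
      · rw [if_neg h, if_neg (by tauto)]
    refine ⟨fun y => F y.1 y.2.1 y.2.2 0, ?_, ?_⟩
    · ext1 u v
      have hv := v.2.2
      rw [h1, hval _ _ _ _ (by omega)]
      simp only [diagonalMatrix, Matrix.map_apply, Matrix.of_apply, apply_ite (MvPolynomial.eval _),
        map_zero, MvPolynomial.eval_X]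
    · ext1 u v
      have hv := v.2.2
      rw [hF, hval _ _ _ _ hv]
      simp only [diagonalMatrix, Matrix.map_apply, Matrix.of_apply, apply_ite (MvPolynomial.eval _),
        map_zero, MvPolynomial.eval_X]

end KroneckerRep

/-! The rank is squeezed between two bounds. Above: `Q_d` has no nonzero homomorphism to `Q_a` when
`a < d`, so the blocks in rows beyond `s_l` and columns up to `r_(l+1)` vanish, and the remaining
rows and columns bound the rank by each number in the formula (`IsGenericHom.polyRank_le`).

Below: specialization cannot raise the rank, so one good homomorphism over `K` suffices. Lay the
rows of all blocks on a line and let the column blocks occupy consecutive intervals, each capped by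
the last row block it can map to; `filled a d n` positions get occupied. `greedyMatrix` puts one
diagonal of ones in each block met by these intervals. A column block inside one row block yields
basis vectors; one crossing a boundary yields sums of two basis vectors, and these are solved
triangularly, forwards after the boundary and backwards before it (`mem_of_staircase`). The columns
and the unoccupied basis vectors thus span, so the rank is at least `filled a d n`.

Finally, unrolling the greedy recursion from its last active cap shows that some number in the
formula is at most `filled a d n` (`exists_le_filled`), which closes the squeeze. -/

/-! ### Rank bounds for matrices -/

/-- Every matrix over a field factors the identity matrix of the size of its rank. -/
theorem Matrix.exists_mul_mul_eq_one {K V W : Type*} [Field K] [Fintype V] [Fintype W]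
    (A : Matrix V W K) :
    ∃ (L : Matrix (Fin A.rank) V K) (R : Matrix W (Fin A.rank) K), L * A * R = 1 := by
  classical
  let e : LinearMap.range A.mulVecLin ≃ₗ[K] (Fin A.rank → K) :=
    LinearEquiv.ofFinrankEq _ _ (Module.finrank_fin_fun K).symm
  -- Retracting onto the column space and taking coordinates there makes `A` surjective; the
  -- retraction gives `L`, and a section of the surjection gives `R`.
  obtain ⟨π, hπ⟩ := LinearMap.exists_leftInverse_of_injective
    (LinearMap.range A.mulVecLin).subtype (Submodule.ker_subtype _)
  have hsurj : Function.Surjective ((e.toLinearMap ∘ₗ π) ∘ₗ A.mulVecLin) := by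
    intro y
    obtain ⟨w, hw⟩ := (e.symm y).2
    refine ⟨w, ?_⟩
    have : π (A.mulVecLin w) = e.symm y := by
      rw [hw]
      exact LinearMap.congr_fun hπ (e.symm y)
    simp only [LinearMap.comp_apply, this]
    simp
  obtain ⟨ρ, hρ⟩ := LinearMap.exists_rightInverse_of_surjective _ (LinearMap.range_eq_top.2 hsurj)
  refine ⟨LinearMap.toMatrix' (e.toLinearMap ∘ₗ π), LinearMap.toMatrix' ρ, ?_⟩
  have h := congrArg LinearMap.toMatrix' hρ
  rw [LinearMap.toMatrix'_comp, LinearMap.toMatrix'_comp, LinearMap.toMatrix'_id] at h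
  have hA : LinearMap.toMatrix' A.mulVecLin = A := LinearMap.toMatrix'_toLin' A
  rwa [hA] at h

/-- Specializing the indeterminates does not increase the rank of a matrix of polynomials. -/
theorem rank_map_eval_le_polyRank {K σ V W : Type*} [Field K] [Fintype V] [Fintype W]
    (A : Matrix V W (MvPolynomial σ K)) (x : σ → K) :
    (A.map (MvPolynomial.eval x)).rank ≤ polyRank A := by
  classical
  obtain ⟨L, R, h⟩ := (A.map (MvPolynomial.eval x)).exists_mul_mul_eq_one
  let C : K → MvPolynomial σ K := MvPolynomial.C
  -- This determinant is a polynomial whose value at `x` is `det 1 = 1`.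
  have hdet : (L.map C * A * R.map C).det ≠ 0 := by
    intro h0
    have := congrArg (MvPolynomial.eval x) h0
    rw [RingHom.map_det, RingHom.mapMatrix_apply, Matrix.map_mul, Matrix.map_mul, Matrix.map_map,
      Matrix.map_map] at this
    have hc : (MvPolynomial.eval x : MvPolynomial σ K → K) ∘ C = id := by
      funext c
      simp [C]
    rw [hc, Matrix.map_id, Matrix.map_id, h] at this
    simp at this
  let ι := algebraMap (MvPolynomial σ K) (FractionRing (MvPolynomial σ K))
  have hdet' : ((L.map C).map ι * A.map ι * (R.map C).map ι).det ≠ 0 := by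
    rw [← Matrix.map_mul, ← Matrix.map_mul, ← RingHom.mapMatrix_apply, ← RingHom.map_det]
    exact fun h0 => hdet
      ((IsFractionRing.injective (MvPolynomial σ K) (FractionRing (MvPolynomial σ K)))
        (h0.trans (map_zero _).symm))
  have hr := Matrix.rank_of_det_ne_zero hdet'
  rw [Fintype.card_fin] at hr
  rw [← hr]
  exact (Matrix.rank_mul_le_left _ _).trans (Matrix.rank_mul_le_right _ _)

/-- A matrix vanishing outside some rows and columns has rank at most their total number. -/
theorem Matrix.rank_le_card_add_card {F V W : Type*} [Field F] [Fintype V] [Fintype W]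
    (A : Matrix V W F) (S : Finset V) (T : Finset W)
    (h : ∀ u ∉ S, ∀ v ∉ T, A u v = 0) : A.rank ≤ S.card + T.card := by
  classical
  rw [Matrix.rank_eq_finrank_span_cols]
  have hle : Submodule.span F (Set.range A.col) ≤
      Submodule.span F ((S.image fun u => (Pi.single u 1 : V → F)) ∪ T.image A.col :
        Finset (V → F)) := by
    rw [Submodule.span_le]
    rintro _ ⟨v, rfl⟩
    by_cases hv : v ∈ T
    · refine Submodule.subset_span ?_
      simp only [Finset.coe_union, Finset.coe_image]
      exact Or.inr ⟨v, hv, rfl⟩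
    · have : A.col v = ∑ u ∈ S, A u v • (Pi.single u 1 : V → F) := by
        ext u
        rw [Finset.sum_apply]
        simp only [Pi.smul_apply, Pi.single_apply, smul_eq_mul, mul_ite, mul_one, mul_zero,
          Finset.sum_ite_eq, Matrix.col_apply]
        split_ifs with hu
        · rfl
        · exact h u hu v hv
      rw [this]
      refine Submodule.sum_mem _ fun u hu => Submodule.smul_mem _ _ (Submodule.subset_span ?_)
      simp only [Finset.coe_union, Finset.coe_image]
      exact Or.inl ⟨u, hu, rfl⟩
  refine (Submodule.finrank_mono hle).trans ((finrank_span_finset_le_card _).trans ?_)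
  exact (Finset.card_union_le _ _).trans (add_le_add Finset.card_image_le Finset.card_image_le)

/-- If the columns of a matrix together with the vectors of a finite set span everything, then the
number of rows is bounded by the rank plus the number of vectors. -/
theorem Matrix.card_le_rank_add_card {F V W : Type*} [Field F] [Fintype V] [Fintype W]
    (A : Matrix V W F) (S : Finset (V → F))
    (h : Submodule.span F (Set.range A.col) ⊔ Submodule.span F (S : Set (V → F)) = ⊤) :
    Fintype.card V ≤ A.rank + S.card := by
  have h1 := Submodule.finrank_add_le_finrank_add_finrank
    (Submodule.span F (Set.range A.col)) (Submodule.span F (S : Set (V → F)))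
  rw [h, finrank_top, Module.finrank_fintype_fun_eq_card, ← Matrix.rank_eq_finrank_span_cols] at h1
  exact h1.trans (add_le_add le_rfl (finrank_span_finset_le_card _))

/-! ### Solving the staircase system -/

/-- The positions `0, 1, 2, …` are cut into rows `[P i, P (i + 1))` and, up to `T n`, into columns
`[T j, T (j + 1))`. Suppose that the submodule `W` contains the vector of each position of a column
lying in a single row, that it contains the sums of the vectors at the top of row `i` and at the
bottom of row `i + 1` for a column meeting both, and the vectors of the positions from `T n` on.
Then it contains all the vectors. -/
theorem mem_of_staircase {F X : Type*} [Ring F] [AddCommGroup X] [Module F X]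
    (W : Submodule F X) (P T : ℕ → ℕ) (E : ℕ → X) (n : ℕ)
    (hP : Monotone P) (hT : Monotone T) (hP0 : P 0 = 0) (hT0 : T 0 = 0)
    (hin : ∀ j < n, (∀ i, T j < P i → T (j + 1) ≤ P i) → ∀ g, T j ≤ g → g < T (j + 1) → E g ∈ W)
    (hacross : ∀ j < n, ∀ i, T j < P (i + 1) → P (i + 1) < T (j + 1) →
      ∃ q, T (j + 1) = T j + q ∧ P i + q ≤ P (i + 1) ∧ P (i + 1) + q ≤ P (i + 2) ∧
        ∀ k < q, E (P (i + 1) + k - q) + E (P (i + 1) + k) ∈ W)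
    (hout : ∀ g, T n ≤ g → E g ∈ W) (g : ℕ) : E g ∈ W := by
  have hcol : ∀ g, g < T n → ∃ j < n, T j ≤ g ∧ g < T (j + 1) := by
    intro g hg
    have hex : ∃ j, g < T j := ⟨n, hg⟩
    classical
    have h1 := Nat.find_spec hex
    have h2 : Nat.find hex ≤ n := Nat.find_min' hex hg
    have h3 : Nat.find hex ≠ 0 := fun h0 => by rw [h0, hT0] at h1; omega
    obtain ⟨j, hj⟩ := Nat.exists_eq_add_one_of_ne_zero h3
    refine ⟨j, by omega, ?_, by rwa [hj] at h1⟩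
    have := Nat.find_min hex (m := j) (by omega)
    omega
  have hlt : ∀ {x y}, T x < T y → x < y := fun h => hT.reflect_lt h
  have hlt' : ∀ {x y}, P x < P y → x < y := fun h => hP.reflect_lt h
  -- the positions that do not precede a row boundary inside their column
  have low : ∀ g, g < T n → (∀ j i, T j ≤ g → g < P i → ¬ P i < T (j + 1)) → E g ∈ W := by
    intro g
    induction g using Nat.strong_induction_on with
    | _ g ih =>
      intro hg hhigh
      obtain ⟨j, hj, hjg, hgj⟩ := hcol g hg
      by_cases hb : ∀ i, T j < P i → T (j + 1) ≤ P i
      · exact hin j hj hb g hjg hgj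
      push Not at hb
      obtain ⟨i, hi1, hi2⟩ := hb
      obtain ⟨i, rfl⟩ := Nat.exists_eq_add_one_of_ne_zero (n := i) (by rintro rfl; omega)
      have hBg : P (i + 1) ≤ g := by
        by_contra hc
        exact hhigh j (i + 1) hjg (by omega) hi2
      obtain ⟨q, hq, hq1, hq2, hE⟩ := hacross j hj i hi1 hi2
      have hk := hE (g - P (i + 1)) (by omega)
      rw [show P (i + 1) + (g - P (i + 1)) = g by omega] at hk
      -- The partner `g - q` lies in row `i` and before column `j`. A row boundary inside its column
      -- is below `P (i + 1)`, hence at most `P i ≤ g - q`: the partner precedes none.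
      have hmem := ih (g - q) (by omega) (by omega) (by
        intro j' i' h1 h2 h3
        have hjj : j' < j := hlt (by omega)
        have h4 : T (j' + 1) ≤ T j := hT hjj
        have hii : i' < i + 1 := hlt' (by omega)
        have h5 : P i' ≤ P i := hP (by omega)
        omega)
      exact (Submodule.add_mem_iff_right _ hmem).1 hk
  -- the positions that do not follow a row boundary inside their column
  have high : ∀ b g, T n - g = b → g < T n → (∀ j i, T j < P i → P i ≤ g → ¬ g < T (j + 1)) →
      E g ∈ W := by
    intro b
    induction b using Nat.strong_induction_on with
    | _ b ih =>
      intro g hb0 hg hlow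
      obtain ⟨j, hj, hjg, hgj⟩ := hcol g hg
      by_cases hb : ∀ i, T j < P i → T (j + 1) ≤ P i
      · exact hin j hj hb g hjg hgj
      push Not at hb
      obtain ⟨i, hi1, hi2⟩ := hb
      obtain ⟨i, rfl⟩ := Nat.exists_eq_add_one_of_ne_zero (n := i) (by rintro rfl; omega)
      have hBg : g < P (i + 1) := by
        by_contra hc
        exact hlow j (i + 1) hi1 (by omega) hgj
      obtain ⟨q, hq, hq1, hq2, hE⟩ := hacross j hj i hi1 hi2
      have hk := hE (g + q - P (i + 1)) (by omega)
      rw [show P (i + 1) + (g + q - P (i + 1)) = g + q by omega, Nat.add_sub_cancel] at hk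
      -- Mirror image: `g + q` lies beyond column `j` but before `P (i + 2)`, so it follows no
      -- boundary inside its own column.
      have hmem : E (g + q) ∈ W := by
        by_cases hgn : T n ≤ g + q
        · exact hout _ hgn
        refine ih (T n - (g + q)) (by omega) _ rfl (by omega) ?_
        intro j' i' h1 h2 h3
        have hjj : j + 1 < j' + 1 := hlt (by omega)
        have h4 : T (j + 1) ≤ T j' := hT (by omega)
        have hii : i + 1 < i' := hlt' (by omega)
        have h5 : P (i + 2) ≤ P i' := hP (by omega)
        omega
      exact (Submodule.add_mem_iff_left _ hmem).1 hk
  by_cases hg : g < T n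
  · by_cases hhigh : ∀ j i, T j ≤ g → g < P i → ¬ P i < T (j + 1)
    · exact low g hg hhigh
    -- Otherwise `g` would lie between two boundaries inside one column, impossible since the row
    -- after a crossed boundary is at least as long as the column.
    refine high _ g rfl hg fun j' i' h1 h2 h3 => hhigh fun j i h4 h5 h6 => ?_
    have hjj : j' = j := by
      have := hlt (x := j') (y := j + 1) (by omega)
      have := hlt (x := j) (y := j' + 1) (by omega)
      omega
    subst hjj
    have hii : i' < i := hlt' (by omega)
    obtain ⟨i', rfl⟩ := Nat.exists_eq_add_one_of_ne_zero (n := i') (by rintro rfl; omega)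
    obtain ⟨j₀, hj₀, h7, h8⟩ := hcol g hg
    have hjj : j' = j₀ := by
      have := hlt (x := j') (y := j₀ + 1) (by omega)
      have := hlt (x := j₀) (y := j' + 1) (by omega)
      omega
    subst hjj
    obtain ⟨q, hq, hq1, hq2, hE⟩ := hacross j' hj₀ i' h1 (by omega)
    have : P (i' + 2) ≤ P i := hP (by omega)
    omega
  · exact hout g (by omega)

/-! ### The index recursion and the greedy count -/

namespace KroneckerIndex

theorem term_succ {m : ℕ} (a : Fin m → ℕ) (i : Fin m) : term a (i + 1) = a i := by
  simp only [term]
  rw [dif_pos (by omega)]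
  rfl

theorem term_le_term {m : ℕ} {a : Fin m → ℕ} (ha : Antitone a) {i j : ℕ} (hi : 1 ≤ i)
    (hij : i ≤ j) : term a j ≤ term a i := by
  unfold term
  split_ifs with h h'
  · exact ha (Fin.mk_le_mk.2 (by omega))
  · omega
  · exact Nat.zero_le _
  · exact le_rfl

/-- As `p` is inherited by smaller indices, its solutions form an initial segment and the maximum is
their number; the value `0` for the empty set fits this. -/
theorem lt_sup_filter_iff {m : ℕ} {p : ℕ → Prop} [DecidablePred p]
    (hp : ∀ i j, 1 ≤ i → i ≤ j → p j → p i) (i : ℕ) :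
    i < ((Finset.Icc 1 m).filter p).sup id ↔ i < m ∧ p (i + 1) := by
  rw [Finset.lt_sup_iff]
  simp only [Finset.mem_filter, Finset.mem_Icc, id]
  constructor
  · rintro ⟨j, ⟨⟨h1, h2⟩, h3⟩, h4⟩
    exact ⟨by omega, hp _ _ (by omega) h4 h3⟩
  · rintro ⟨h1, h2⟩
    exact ⟨i + 1, ⟨⟨by omega, by omega⟩, h2⟩, by omega⟩

variable {m n : ℕ} (a : Fin m → ℕ) (d : Fin n → ℕ)

/-- The number of indices `i` with `d_(j+1) ≤ a_i`, for antitone `a`. -/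
def height (j : ℕ) : ℕ := ((Finset.Icc 1 m).filter fun i => term d (j + 1) ≤ term a i).sup id

/-- The total size at the vertex `1` of the first `k` summands. -/
def offset (k : ℕ) : ℕ := ∑ i ∈ Finset.Icc 1 k, (term a i - 1)

/-- The number of positions filled greedily by the first `j` summands of `N`, where the
`(j+1)`-st one may only use the first `height a d j` summands of `M`. -/
def filled : ℕ → ℕ
  | 0 => 0
  | j + 1 => min (filled j + (term d (j + 1) - 1)) (offset a (height a d j))

theorem offset_succ (k : ℕ) : offset a (k + 1) = offset a k + (term a (k + 1) - 1) :=
  Finset.sum_Icc_succ_top (by omega) _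

theorem offset_mono : Monotone (offset a) :=
  monotone_nat_of_le_succ fun k => by rw [offset_succ]; omega

variable {a d}

theorem lt_height_iff (ha : Antitone a) (i j : ℕ) :
    i < height a d j ↔ i < m ∧ term d (j + 1) ≤ term a (i + 1) :=
  lt_sup_filter_iff (fun _ _ hi hij h => h.trans (term_le_term ha hi hij)) i

theorem lt_r_succ_iff (hd : Antitone d) (j l : ℕ) :
    j < r a d (l + 1) ↔ j < n ∧ term a (s a d l + 1) < term d (j + 1) := by
  rw [r_succ]
  exact lt_sup_filter_iff (fun _ _ hi hij h => h.trans_le (term_le_term hd hi hij)) j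

theorem height_mono (ha : Antitone a) (hd : Antitone d) : Monotone (height a d) := by
  intro j j' hj
  by_contra hc
  push Not at hc
  have h1 := (lt_height_iff (d := d) ha _ j).1 hc
  have h2 := (lt_height_iff (d := d) ha (height a d j') j').2
    ⟨h1.1, (term_le_term hd (by omega) (by omega)).trans h1.2⟩
  omega

/-- Caps only grow with `j`, because smaller `d_j` reach more rows; so the next cap never cuts into
what is already filled. -/
theorem filled_le_offset (ha : Antitone a) (hd : Antitone d) (j : ℕ) :
    filled a d j ≤ offset a (height a d j) := by
  cases j with
  | zero => exact Nat.zero_le _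
  | succ j =>
    exact (min_le_right _ _).trans (offset_mono a (height_mono ha hd (Nat.le_succ j)))

theorem filled_mono (ha : Antitone a) (hd : Antitone d) : Monotone (filled a d) :=
  monotone_nat_of_le_succ fun j => le_min (Nat.le_add_right _ _) (filled_le_offset ha hd j)

/-- Either no cap was ever active, or `j` is the last step whose minimum is taken to be the cap;
after it every column block is counted in full. -/
theorem filled_eq (k : ℕ) :
    filled a d k = offset d k ∨ ∃ j < k, filled a d k =
      offset a (height a d j) + ∑ i ∈ Finset.Icc (j + 2) k, (term d i - 1) := by
  induction k with
  | zero => exact Or.inl (by simp [filled, offset])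
  | succ k ih =>
    rw [filled]
    rcases min_choice (filled a d k + (term d (k + 1) - 1)) (offset a (height a d k)) with h | h
    · rw [h]
      rcases ih with h' | ⟨j, hj, h'⟩
      · exact Or.inl (by rw [h', offset_succ])
      · refine Or.inr ⟨j, by omega, ?_⟩
        rw [h', Finset.sum_Icc_succ_top (by omega), add_assoc]
    · refine Or.inr ⟨k, by omega, ?_⟩
      rw [h, Finset.Icc_eq_empty (by omega), Finset.sum_empty, add_zero]

theorem sum_Icc_anti (f : ℕ → ℕ) {x y : ℕ} (h : x ≤ y) (k : ℕ) :
    ∑ i ∈ Finset.Icc y k, f i ≤ ∑ i ∈ Finset.Icc x k, f i :=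
  Finset.sum_le_sum_of_subset (Finset.Icc_subset_Icc_left h)

/-- One of the numbers in the rank formula is at most the number of positions filled greedily. -/
theorem exists_le_filled (ha : Antitone a) (hd : Antitone d) (hd0 : ∀ j, 0 < d j) :
    ∃ i ≤ t a d - 1, offset a (s a d i) +
      ∑ j ∈ Finset.Icc (r a d (i + 1) + 1) (r a d (t a d)), (term d j - 1) ≤ filled a d n := by
  obtain ⟨ht1, ht⟩ := t_spec (a := a) hd0
  rw [ht]
  have hs0 : s a d 0 = 0 := rfl
  rcases filled_eq (a := a) (d := d) n with h | ⟨j, hj, h⟩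
  · refine ⟨0, Nat.zero_le _, ?_⟩
    rw [h, hs0]
    simpa [offset] using sum_Icc_anti (fun j => term d j - 1) (by omega : 1 ≤ r a d (0 + 1) + 1) n
  -- Take the least `i` with `r_(i+1) > j`. Then the sum from `r_(i+1) + 1` is no longer than the
  -- one from `j + 2`, and `r_i ≤ j` gives `s_i = height a d (r_i) ≤ height a d j` when `i > 0`.
  · have hex : ∃ i, j + 1 ≤ r a d (i + 1) :=
      ⟨t a d - 1, by rw [Nat.sub_add_cancel ht1, ht]; omega⟩
    have h1 := Nat.find_spec hex
    have h2 : Nat.find hex ≤ t a d - 1 :=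
      Nat.find_min' hex (by rw [Nat.sub_add_cancel ht1, ht]; omega)
    have h3 : ∀ i < Nat.find hex, r a d (i + 1) ≤ j := fun i hi => by
      have := Nat.find_min hex hi
      omega
    generalize Nat.find hex = i at h1 h2 h3
    refine ⟨i, h2, ?_⟩
    rw [h]
    refine add_le_add (offset_mono a ?_) (sum_Icc_anti _ (by omega) _)
    cases i with
    | zero => rw [hs0]; exact Nat.zero_le _
    | succ i =>
      rw [s_succ]
      exact height_mono ha hd (h3 i (by omega))

/-- The blocks in the first `r_(l+1)` columns and below the first `s_l` rows vanish. -/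
theorem lt_of_s_le_of_lt_r (ha : Antitone a) (hd : Antitone d) {l : ℕ} {i : Fin m} {j : Fin n}
    (hi : s a d l ≤ i) (hj : (j : ℕ) < r a d (l + 1)) : a i < d j := by
  rw [← term_succ a, ← term_succ d]
  exact (term_le_term ha (by omega) (by omega)).trans_lt ((lt_r_succ_iff hd _ _).1 hj).2

end KroneckerIndex

/-! ### Vanishing blocks and the upper bound -/

namespace KroneckerRep

open KroneckerIndex

/-- Specializing the indeterminates turns a homomorphism over the polynomial ring into a
homomorphism over the field. -/
theorem IsHom.map_eval {K σ V₁ V₂ W₁ W₂ : Type*} [CommSemiring K] [Fintype V₁] [Fintype W₂]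
    {N : KroneckerRep K W₁ W₂} {M : KroneckerRep K V₁ V₂}
    {φ₁ : Matrix V₁ W₁ (MvPolynomial σ K)} {φ₂ : Matrix V₂ W₂ (MvPolynomial σ K)}
    (h : IsHom (N.map (MvPolynomial.C (σ := σ))) (M.map (MvPolynomial.C (σ := σ))) φ₁ φ₂)
    (x : σ → K) :
    IsHom N M (φ₁.map (MvPolynomial.eval x)) (φ₂.map (MvPolynomial.eval x)) := by
  have hc : (MvPolynomial.eval x : MvPolynomial σ K → K) ∘ MvPolynomial.C = id := by
    funext c
    simp
  constructor
  · have := congrArg (fun A => A.map (MvPolynomial.eval x)) h.comm_α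
    simpa only [Matrix.map_mul, KroneckerRep.map, Matrix.map_map, hc, Matrix.map_id] using this
  · have := congrArg (fun A => A.map (MvPolynomial.eval x)) h.comm_β
    simpa only [Matrix.map_mul, KroneckerRep.map, Matrix.map_map, hc, Matrix.map_id] using this

section

variable {K : Type*} [Field K] {m n : ℕ} {a : Fin m → ℕ} {d : Fin n → ℕ}

/-- There are no nonzero homomorphisms from `Q_d` to `Q_a` for `a < d`. -/
theorem IsGenericHom.apply_eq_zero [Infinite K] (hd0 : ∀ j, 0 < d j) {σ : Type*}
    {φ₁ : Matrix (Σ i, Fin (a i - 1)) (Σ j, Fin (d j - 1)) (MvPolynomial σ K)}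
    {φ₂ : Matrix (Σ i, Fin (a i)) (Σ j, Fin (d j)) (MvPolynomial σ K)}
    (hφ : IsGenericHom (preprojective K d) (preprojective K a) φ₁ φ₂)
    {u : Σ i, Fin (a i - 1)} {v : Σ j, Fin (d j - 1)} (h : a u.1 < d v.1) : φ₁ u v = 0 := by
  -- Over an infinite field it suffices to check values. Each specialization is a homomorphism over
  -- `K`, hence also one of the diagonal pair, whose block is zero here.
  refine MvPolynomial.funext fun x => ?_
  obtain ⟨y, hy, -⟩ := (isGenericHom_diagonalPair (K := K) a d hd0).exists_specialization _ _
    (hφ.isHom.map_eval x)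
  have := congrFun (congrFun hy u) v
  rw [Matrix.map_apply, Matrix.map_apply, diagonalMatrix, Matrix.of_apply, if_neg (by omega)] at this
  rw [← this, map_zero, map_zero]

theorem sum_filter_eq_sum_Icc (a : Fin m → ℕ) (x y : ℕ) (hy : y ≤ m) :
    ∑ i ∈ Finset.univ.filter (fun i : Fin m => x ≤ (i : ℕ) ∧ (i : ℕ) < y), (a i - 1) =
      ∑ i ∈ Finset.Icc (x + 1) y, (term a i - 1) := by
  refine Finset.sum_bij (fun i _ => (i : ℕ) + 1) ?_ ?_ ?_ ?_
  · intro i hi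
    simp only [Finset.mem_filter, Finset.mem_univ, true_and] at hi
    simp only [Finset.mem_Icc]
    omega
  · intro i _ j _ h
    exact Fin.ext (by omega)
  · intro i hi
    simp only [Finset.mem_Icc] at hi
    exact ⟨⟨i - 1, by omega⟩, by simp only [Finset.mem_filter, Finset.mem_univ, true_and]; omega,
      by simp only; omega⟩
  · intro i _
    rw [term_succ]

theorem card_filter_sigma (a : Fin m → ℕ) (x y : ℕ) (hy : y ≤ m) :
    (Finset.univ.filter fun u : Σ i, Fin (a i - 1) => x ≤ (u.1 : ℕ) ∧ (u.1 : ℕ) < y).card =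
      ∑ i ∈ Finset.Icc (x + 1) y, (term a i - 1) := by
  have : (Finset.univ.filter fun u : Σ i, Fin (a i - 1) => x ≤ (u.1 : ℕ) ∧ (u.1 : ℕ) < y) =
      (Finset.univ.filter (fun i : Fin m => x ≤ (i : ℕ) ∧ (i : ℕ) < y)).sigma
        fun _ => Finset.univ := by
    ext u
    simp
  rw [this, Finset.card_sigma, ← sum_filter_eq_sum_Icc a x y hy]
  simp

theorem card_sigma_eq_offset (a : Fin m → ℕ) :
    Fintype.card (Σ i, Fin (a i - 1)) = offset a m := by
  rw [offset, ← card_filter_sigma a 0 m le_rfl, ← Finset.card_univ]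
  congr 1
  ext u
  simp

/-- Every block-triangular zero pattern bounds the rank of a generic homomorphism. -/
theorem IsGenericHom.polyRank_le [Infinite K] (ha : Antitone a) (hd : Antitone d)
    (hd0 : ∀ j, 0 < d j) {σ : Type*}
    {φ₁ : Matrix (Σ i, Fin (a i - 1)) (Σ j, Fin (d j - 1)) (MvPolynomial σ K)}
    {φ₂ : Matrix (Σ i, Fin (a i)) (Σ j, Fin (d j)) (MvPolynomial σ K)}
    (hφ : IsGenericHom (preprojective K d) (preprojective K a) φ₁ φ₂) (l : ℕ) :
    polyRank φ₁ ≤ offset a (s a d l) +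
      ∑ j ∈ Finset.Icc (r a d (l + 1) + 1) n, (term d j - 1) := by
  have hs : s a d l ≤ m := by
    cases l with
    | zero => exact Nat.zero_le _
    | succ l =>
      rw [s_succ]
      refine Finset.sup_le fun i hi => ?_
      simp only [Finset.mem_filter, Finset.mem_Icc] at hi
      exact hi.1.2
  rw [offset, ← card_filter_sigma a 0 _ hs, ← card_filter_sigma d _ n le_rfl]
  refine Matrix.rank_le_card_add_card _ _ _ fun u hu v hv => ?_
  simp only [Finset.mem_filter, Finset.mem_univ, true_and, Nat.zero_le, Fin.is_lt, and_true,
    not_lt, not_le] at hu hv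
  rw [Matrix.map_apply, hφ.apply_eq_zero hd0 (lt_of_s_le_of_lt_r ha hd hu hv), map_zero]

/-! ### The greedy homomorphism and the lower bound -/

/-- The position, among the diagonals of the block `(i, j)`, of the nonzero diagonal in the
specialization realizing the greedy filling. -/
def shift (a : Fin m → ℕ) (d : Fin n → ℕ) (i j : ℕ) : ℕ :=
  min (filled a d j - offset a i) (term a (i + 1) - term d (j + 1))

/-- The values of the indeterminates realizing the greedy filling. -/
def greedyPoint (K : Type*) [Field K] (a : Fin m → ℕ) (d : Fin n → ℕ) : Fin m × Fin n × ℕ → K :=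
  fun z => if (filled a d z.2.1 < offset a (z.1 + 1) ∧ offset a z.1 < filled a d (z.2.1 + 1)) ∧
    z.2.2 = shift a d z.1 z.2.1 then 1 else 0

/-- The component at the vertex `1` of the homomorphism realizing the greedy filling. -/
noncomputable def greedyMatrix (K : Type*) [Field K] (a : Fin m → ℕ) (d : Fin n → ℕ) :
    Matrix (Σ i, Fin (a i - 1)) (Σ j, Fin (d j - 1)) K :=
  (diagonalMatrix K a d (fun i => a i - 1) (fun j => d j - 1)).map
    (MvPolynomial.eval (greedyPoint K a d))

theorem greedyMatrix_apply (u : Σ i, Fin (a i - 1)) (v : Σ j, Fin (d j - 1)) :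
    greedyMatrix K a d u v =
      if ((v.2 : ℕ) ≤ u.2 ∧ ((u.2 : ℕ) - v.2) + term d (v.1 + 1) ≤ term a (u.1 + 1)) ∧
        (filled a d v.1 < offset a (u.1 + 1) ∧ offset a u.1 < filled a d (v.1 + 1)) ∧
        (u.2 : ℕ) - v.2 = shift a d u.1 v.1 then 1 else 0 := by
  rw [greedyMatrix, Matrix.map_apply, diagonalMatrix, Matrix.of_apply,
    apply_ite (MvPolynomial.eval _), MvPolynomial.eval_X, map_zero, term_succ, term_succ,
    greedyPoint, ← ite_and]

/-- The standard basis vector of the `g`-th row, counted through all the blocks. -/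
def rowVec (K : Type*) [Field K] (a : Fin m → ℕ) (g : ℕ) : (Σ i, Fin (a i - 1)) → K :=
  fun u => if offset a u.1 + u.2 = g then 1 else 0

theorem offset_add_lt (u : Σ i, Fin (a i - 1)) :
    offset a u.1 + u.2 < offset a (u.1 + 1) := by
  have := u.2.2
  rw [offset_succ, term_succ]
  omega

/-- The intervals from `offset a i` to `offset a (i + 1)` are disjoint, so a global position
determines its block and its row there. -/
theorem rowVec_offset_add (u : Σ i, Fin (a i - 1)) :
    rowVec K a (offset a u.1 + u.2) = Pi.single u 1 := by
  ext w
  rw [rowVec, Pi.single_apply]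
  congr 1
  refine propext ⟨fun h => ?_, fun h => by rw [h]⟩
  have hu := offset_add_lt u
  have hw := offset_add_lt w
  have h1 := (offset_mono a).reflect_lt (lt_of_le_of_lt (Nat.le_add_right _ _) (h ▸ hw))
  have h2 := (offset_mono a).reflect_lt (lt_of_le_of_lt (Nat.le_add_right _ _) (h.symm ▸ hu))
  obtain ⟨i, o⟩ := u
  obtain ⟨i', o'⟩ := w
  obtain rfl : i' = i := Fin.ext (by simp only at h1 h2; omega)
  simp only [Nat.add_left_cancel_iff] at h
  rw [Fin.ext h]

theorem exists_offset_le_lt {g k : ℕ} (h : g < offset a k) :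
    ∃ i < k, offset a i ≤ g ∧ g < offset a (i + 1) := by
  induction k with
  | zero => simp [offset] at h
  | succ k ih =>
    by_cases hk : g < offset a k
    · obtain ⟨i, hi, h'⟩ := ih hk
      exact ⟨i, by omega, h'⟩
    · exact ⟨k, by omega, by omega, h⟩

/-- A basis vector of a position in a column filling part of a single row is a column. -/
theorem exists_col_eq_rowVec (ha : Antitone a)
    (hd0 : ∀ j, 0 < d j) (j : Fin n)
    (hb : ∀ i, filled a d j < offset a i → filled a d (j + 1) ≤ offset a i) (g : ℕ)
    (hjg : filled a d j ≤ g) (hgj : g < filled a d (j + 1)) :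
    ∃ v, (greedyMatrix K a d).col v = rowVec K a g := by
  have hT : filled a d (j + 1) = min (filled a d j + (term d (j + 1) - 1))
    (offset a (height a d j)) := rfl
  obtain ⟨i, hi, hig, hgi⟩ := exists_offset_le_lt (a := a) (g := g) (k := height a d j) (by omega)
  obtain ⟨him, hda⟩ := (lt_height_iff ha _ _).1 hi
  have hd1 : 0 < term d (j + 1) := by rw [term_succ]; exact hd0 j
  have hs := offset_succ a i
  have h1 : offset a i ≤ filled a d j := by
    by_contra hc
    have := hb i (by omega)
    omega
  have h2 : filled a d (j + 1) ≤ offset a (i + 1) := hb _ (by omega)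
  have hsh : shift a d i j = min (filled a d j - offset a i) (term a (i + 1) - term d (j + 1)) :=
    rfl
  have hdj := term_succ d j
  -- Uncapped, the diagonal starts at `filled a d j`. If the cap cuts the block short, the diagonal
  -- is pushed up to end at the bottom of row block `i`, and only its last columns are needed.
  refine ⟨⟨j, ⟨g - offset a i - shift a d i j, by omega⟩⟩, ?_⟩
  ext u
  rw [Matrix.col_apply, greedyMatrix_apply, rowVec]
  have hu := offset_add_lt u
  simp only
  rcases lt_trichotomy (u.1 : ℕ) i with h | h | h
  · have : offset a (u.1 + 1) ≤ offset a i := offset_mono a h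
    rw [if_neg (by omega), if_neg (by omega)]
  · rw [h]
    congr 1
    apply propext
    omega
  · have : offset a (i + 1) ≤ offset a u.1 := offset_mono a h
    rw [if_neg (by omega), if_neg (by omega)]

/-- A column crossing the boundary between two rows meets each of them in one diagonal. -/
theorem exists_col_eq_rowVec_add_rowVec (ha : Antitone a)
    (hd0 : ∀ j, 0 < d j) (j : Fin n) (i : ℕ)
    (h1 : filled a d j < offset a (i + 1)) (h2 : offset a (i + 1) < filled a d (j + 1)) :
    ∃ q, filled a d (j + 1) = filled a d j + q ∧ offset a i + q ≤ offset a (i + 1) ∧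
      offset a (i + 1) + q ≤ offset a (i + 2) ∧ ∀ k < q, ∃ v, (greedyMatrix K a d).col v =
        rowVec K a (offset a (i + 1) + k - q) + rowVec K a (offset a (i + 1) + k) := by
  have hT : filled a d (j + 1) = min (filled a d j + (term d (j + 1) - 1))
    (offset a (height a d j)) := rfl
  have hi : i + 1 < height a d j := (offset_mono a).reflect_lt (by omega)
  obtain ⟨him, hda⟩ := (lt_height_iff ha _ _).1 hi
  have hda' := hda.trans (term_le_term ha (by omega) (by omega : i + 1 ≤ i + 1 + 1))
  have hd1 : 0 < term d (j + 1) := by rw [term_succ]; exact hd0 j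
  have hs := offset_succ a i
  have hs' := offset_succ a (i + 1)
  have hh : offset a (i + 1 + 1) ≤ offset a (height a d j) := offset_mono a hi
  have hdj := term_succ d j
  have hsh : shift a d i j = min (filled a d j - offset a i) (term a (i + 1) - term d (j + 1)) :=
    rfl
  have hsh' : shift a d (i + 1) j =
    min (filled a d j - offset a (i + 1)) (term a (i + 1 + 1) - term d (j + 1)) := rfl
  rw [show i + 2 = i + 1 + 1 from rfl]
  -- No cap is active: row block `i + 1` alone has room for all `d - 1` columns. The shift in row
  -- block `i` is the largest possible, so that diagonal ends at the boundary; in row block `i + 1`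
  -- truncated subtraction makes the shift `0`, so that diagonal starts there.
  refine ⟨term d (j + 1) - 1, by omega, by omega, by omega, fun k hk => ⟨⟨j, ⟨k, by omega⟩⟩, ?_⟩⟩
  ext u
  rw [Matrix.col_apply, greedyMatrix_apply, Pi.add_apply, rowVec, rowVec]
  have hu := offset_add_lt u
  simp only
  rcases lt_trichotomy (u.1 : ℕ) i with h | h | h
  · have : offset a (u.1 + 1) ≤ offset a i := offset_mono a h
    rw [if_neg (by omega), if_neg (by omega), if_neg (by omega), add_zero]
  · rw [h] at hu ⊢
    rw [if_neg (by omega : ¬ offset a i + (u.2 : ℕ) = offset a (i + 1) + k), add_zero]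
    congr 1
    apply propext
    omega
  · rcases (Nat.succ_le_of_lt h).eq_or_lt with h' | h'
    · rw [Nat.succ_eq_add_one] at h'
      rw [← h'] at hu ⊢
      rw [if_neg (by omega : ¬ offset a (i + 1) + (u.2 : ℕ) = offset a (i + 1) + k -
        (term d (j + 1) - 1)), zero_add]
      congr 1
      apply propext
      omega
    · have : offset a (i + 1 + 1) ≤ offset a u.1 := offset_mono a h'
      rw [if_neg (by omega), if_neg (by omega), if_neg (by omega), add_zero]

/-- The rank of the greedy specialization is at least the number of positions filled. -/
theorem filled_le_rank_greedyMatrix (ha : Antitone a) (hd : Antitone d)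
    (hd0 : ∀ j, 0 < d j) : filled a d n ≤ (greedyMatrix K a d).rank := by
  classical
  -- Basis vectors of the unoccupied positions: at most `offset a m - filled a d n` of them, so
  -- spanning leaves rank at least `filled a d n` to the columns.
  let S : Finset ((Σ i, Fin (a i - 1)) → K) :=
    (Finset.Ico (filled a d n) (offset a m)).image (rowVec K a)
  let W := Submodule.span K (Set.range (greedyMatrix K a d).col) ⊔
    Submodule.span K (S : Set ((Σ i, Fin (a i - 1)) → K))
  have hcol : ∀ v, (greedyMatrix K a d).col v ∈ W := fun v =>
    Submodule.mem_sup_left (Submodule.subset_span ⟨v, rfl⟩)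
  have hmem : ∀ g, rowVec K a g ∈ W := by
    refine mem_of_staircase W (offset a) (filled a d) (rowVec K a) n (offset_mono a)
      (filled_mono ha hd) (by simp [offset]) rfl ?_ ?_ ?_
    · intro j hj hb g h1 h2
      obtain ⟨v, hv⟩ := exists_col_eq_rowVec (K := K) ha hd0 ⟨j, hj⟩ hb g h1 h2
      exact hv ▸ hcol v
    · intro j hj i h1 h2
      obtain ⟨q, hq, hq1, hq2, h⟩ :=
        exists_col_eq_rowVec_add_rowVec (K := K) ha hd0 ⟨j, hj⟩ i h1 h2
      refine ⟨q, hq, hq1, hq2, fun k hk => ?_⟩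
      obtain ⟨v, hv⟩ := h k hk
      exact hv ▸ hcol v
    · intro g hg
      by_cases hgm : g < offset a m
      · refine Submodule.mem_sup_right (Submodule.subset_span ?_)
        exact Finset.mem_coe.2 (Finset.mem_image_of_mem _ (Finset.mem_Ico.2 ⟨hg, hgm⟩))
      · have : rowVec K a g = 0 := by
          ext u
          have hu := offset_add_lt u
          have : offset a (u.1 + 1) ≤ offset a m := offset_mono a u.1.2
          exact if_neg (by omega)
        rw [this]
        exact W.zero_mem
  have htop : W = ⊤ := by
    rw [eq_top_iff, ← (Pi.basisFun K (Σ i, Fin (a i - 1))).span_eq, Submodule.span_le]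
    rintro _ ⟨u, rfl⟩
    rw [Pi.basisFun_apply, ← rowVec_offset_add]
    exact hmem _
  have h1 := Matrix.card_le_rank_add_card _ S htop
  have h2 : S.card ≤ offset a m - filled a d n :=
    Finset.card_image_le.trans (Nat.card_Ico _ _).le
  have h3 : filled a d n ≤ offset a m := by
    refine (filled_le_offset ha hd n).trans (offset_mono a ?_)
    by_contra hc
    have := ((lt_height_iff (d := d) ha m n).1 (by omega)).1
    omega
  rw [card_sigma_eq_offset] at h1
  omega

/-- The greedy matrix belongs to a homomorphism over `K`, so any generic homomorphism specializes to
it. -/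
theorem IsGenericHom.filled_le_polyRank (ha : Antitone a) (hd : Antitone d)
    (hd0 : ∀ j, 0 < d j) {σ : Type*}
    {φ₁ : Matrix (Σ i, Fin (a i - 1)) (Σ j, Fin (d j - 1)) (MvPolynomial σ K)}
    {φ₂ : Matrix (Σ i, Fin (a i)) (Σ j, Fin (d j)) (MvPolynomial σ K)}
    (hφ : IsGenericHom (preprojective K d) (preprojective K a) φ₁ φ₂) :
    filled a d n ≤ polyRank φ₁ := by
  obtain ⟨x, hx, -⟩ := hφ.exists_specialization _ _
    ((isGenericHom_diagonalPair a d hd0).isHom.map_eval (greedyPoint K a d))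
  refine (filled_le_rank_greedyMatrix (K := K) ha hd hd0).trans ?_
  rw [greedyMatrix, ← hx]
  exact rank_map_eval_le_polyRank φ₁ x

end

end KroneckerRep

theorem corollary5 {K : Type*} [Field K] [IsAlgClosed K] {m n : ℕ}
    (a : Fin m → ℕ) (d : Fin n → ℕ)
    (ha : Antitone a) (hd : Antitone d) (ha0 : ∀ i, 0 < a i) (hd0 : ∀ j, 0 < d j)
    {σ : Type*}
    (φ₁ : Matrix (Σ i, Fin (a i - 1)) (Σ j, Fin (d j - 1)) (MvPolynomial σ K))
    (φ₂ : Matrix (Σ i, Fin (a i)) (Σ j, Fin (d j)) (MvPolynomial σ K))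
    (hφ : KroneckerRep.IsGenericHom (KroneckerRep.preprojective K d)
      (KroneckerRep.preprojective K a) φ₁ φ₂) :
    IsLeast
      {x : ℕ | ∃ i : ℕ, i ≤ KroneckerIndex.t a d - 1 ∧
        x = ∑ j ∈ Finset.Icc 1 (KroneckerIndex.s a d i), (KroneckerIndex.term a j - 1) +
          ∑ j ∈ Finset.Icc (KroneckerIndex.r a d (i + 1) + 1)
              (KroneckerIndex.r a d (KroneckerIndex.t a d)),
            (KroneckerIndex.term d j - 1)}
      (polyRank φ₁) := by
  have : Infinite K := IsAlgClosed.instInfinite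
  have hle : ∀ l, _ := fun l => hφ.polyRank_le ha hd hd0 l
  obtain ⟨ht1, ht⟩ := KroneckerIndex.t_spec (a := a) hd0
  constructor
  -- For this `i` the number in the formula is at most `filled a d n`, hence at most the rank; the
  -- upper bound at the same `i` forces equality.
  · obtain ⟨i, hi, h⟩ := KroneckerIndex.exists_le_filled ha hd hd0
    have h' := h.trans (hφ.filled_le_polyRank ha hd hd0)
    rw [ht] at h'
    refine ⟨i, hi, ?_⟩
    rw [ht]
    exact le_antisymm (hle i) h'
  · rintro _ ⟨i, -, rfl⟩
    rw [ht]
    exact hle i
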